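/- **Conventions.** A $4$-colored graph is a simple graph $G=(V,E)$ whose edges are colored by $A,B,C,D$ so that distinct edges at a vertex have distinct colors. Let $\Gamma=\mathbb Z_2*\mathbb Z_2*\mathbb Z_2*\mathbb Z_2$ with generators $A,B,C,D$ of order two, and $\widetilde\Gamma=\langle A,B,C\rangle\le\Gamma$. The generator $c$ acts on $V$ by moving a vertex across its edge of color $c$ if there is one, and fixing it otherwise. Two vertices $x,y$ have the same $r$-type if there is an isomorphism between the spanned subgraphs on the balls $B_r(x)$, $B_r(y)$ that preserves colors and maps $x$ to $y$; let $\alpha_r(x)$ be the $r$-type of $x$ and $U^r_G=\{\alpha_r(x): x\in V\}$. The type space $X_G$ is the set of chains $\alpha_1\prec\alpha_2\prec\cdots$ with $\alpha_r\in U^r_G$, where $\alpha_r\prec\alpha_{r+1}$ means that some $x\in V$ has $\alpha_{r}(x)=\alpha_{r}$ and $\alpha_{r+1}(x)=\alpha_{r+1}$. $\Gamma$ acts on $X_G$: the generator $c$ maps $(\alpha_r)_r$ to $(\beta_r)_r$, where $\beta_r=\alpha_r(c\cdot x)$ for any $x$ with $\alpha_{r+1}(x)=\alpha_{r+1}$.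 The leaf of $\alpha\in X_G$ is the Schreier graph of its orbit $\Gamma\alpha$ with respect to $\{A,B,C,D\}$. A graph is amenable if for every $\varepsilon>0$ there is a finite nonempty set $\Omega$ of vertices with $|\partial\Omega|<\varepsilon|\Omega|$, where $\partial\Omega$ is the set of those vertices in $\Omega$ that have a neighbor outside $\Omega$ (so finite graphs are amenable). **The construction.** Fix an integer $m>10$ and finite index normal subgroups $N_1\ge N_2\ge\cdots$ of $\widetilde\Gamma$ with $\bigcap_i N_i=\{1\}$. Let $w_1,w_2,\dots$ be the nonempty reduced words in $A,B,C,D$ ordered by length and then lexicographically: $A,B,C,D,AB,AC,AD,BA,\dots$. Finite $4$-colored graphs $G_0\subset G_1\subset\cdots$ with vertices $r_n\in V(G_n)$ are constructed as follows. $G_0$ is a single vertex $p=r_0$. $G_1$ consists of $p$ and a triangle with edges colored $A,B,C$, with an edge of color $D$ joining $p$ to a vertex $q$ of the triangle; $r_1\neq q$ is another vertex of the triangle. In step $n\ge 2$, put $s_i=m^i2^{|V(G_{i-1})|}$ for $1\le i\le n$. Choose a $4$-colored graph $H_n$ with $\operatorname{diam}H_n\ge 10s_n$ that is a cycle of even length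 with edges colored alternately $A,B$ if $n$ is even, and is the Cayley graph of some $\widetilde\Gamma/N_i$ with respect to $A,B,C$ if $n$ is odd. Choose a partition $V(H_n)=R^n_1\sqcup\cdots\sqcup R^n_{n+1}$ such that for every $i\le n$ distinct points of $R^n_i$ are at distance at least $2s_i$ in $H_n$, and every vertex of $H_n$ is at distance at most $10s_i$ from $R^n_i$. For each $i\le n-1$ and each $v\in R^n_i$, join $v$ by an edge of color $D$ to the vertex $r_{i-1}$ of a new copy of $G_{i-1}$. Join one vertex of $R^n_n$ by an edge of color $D$ to the vertex $r_{n-1}$ of $G_{n-1}$. Choose $x_n\ne r_n$ in $R^n_{n+1}$ and a word $w\in\{w_{n-1},w_n\}$; write $w=a_k\cdots a_1$ with letters $a_j$. Attach at $x_n$ a path of new vertices whose successive edges, starting from $x_n$, are colored $D,a_1,a_2,\dots,a_k$ if $a_1\ne D$, and $a_1,a_2,\dots,a_k$ if $a_1=D$. The result is $G_n$. Finally, let $G=\bigcup_n G_n$. **Proposition.** For every $m>10$, every sequence $(N_i)$ as above and every graph $G$ obtained by this construction (with any choices), all leaves of the action of $\Gamma$ on the type space $X_G$ are amenable graphs. 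-/

import Mathlib

namespace TypeSpaceAction

/-! ### Properly edge-coloured graphs and the group -/

/-- The four colours. -/
inductive Color : Type
  | A
  | B
  | C
  | D
  deriving DecidableEq

/-- A simple graph on `V` with edges properly coloured by `A, B, C, D`:
`adj c x y` says that `x` and `y` are joined by an edge of colour `c`. -/
structure ColoredGraph (V : Type*) where
  adj : Color → V → V → Prop
  symm : ∀ {c x y}, adj c x y → adj c y x
  irrefl : ∀ {c x}, ¬ adj c x x
  color_unique : ∀ {c c' x y}, adj c x y → adj c' x y → c = c'
  proper : ∀ {c x y z}, adj c x y → adj c x z → y = z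

/-- The group `ℤ/2 * ℤ/2 * ℤ/2 * ℤ/2`. -/
abbrev Gam : Type := Monoid.CoprodI (fun _ : Color => Multiplicative (ZMod 2))

/-- The generator of order two of the free factor indexed by `c`. -/
def gen (c : Color) : Gam :=
  Monoid.CoprodI.of (M := fun _ : Color => Multiplicative (ZMod 2)) (i := c)
    (Multiplicative.ofAdd 1)

/-- The subgroup generated by `A, B, C`. -/
def GamTilde : Subgroup Gam :=
  Subgroup.closure {gen Color.A, gen Color.B, gen Color.C}

/-- The action of `Γ` defined by four involutive permutations. -/
noncomputable def homOfInvolutions {X : Type*} (σ : Color → Equiv.Perm X)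
    (hσ : ∀ c, σ c * σ c = 1) : Gam →* Equiv.Perm X :=
  Monoid.CoprodI.lift fun c =>
    { toFun := fun z => σ c ^ (Multiplicative.toAdd z).val
      map_one' := by simp
      map_mul' := by
        intro a b
        rw [toAdd_mul, ← pow_add, ZMod.val_add, ← pow_mod_orderOf (σ c) (_ + _),
          ← pow_mod_orderOf (σ c) (_ % _)]
        congr 1
        have h2 : orderOf (σ c) ∣ 2 := orderOf_dvd_of_pow_eq_one (by rw [pow_two, hσ])
        exact Nat.mod_mod_of_dvd _ h2 }

namespace ColoredGraph

variable {V : Type*} (G : ColoredGraph V)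

/-- The underlying simple graph. -/
def graph : SimpleGraph V where
  Adj x y := ∃ c, G.adj c x y
  symm := ⟨fun _ _ ⟨c, h⟩ => ⟨c, G.symm h⟩⟩
  loopless := ⟨fun _ ⟨_, h⟩ => G.irrefl h⟩

open Classical in
/-- Cross the edge of colour `c` at `x`; stay at `x` if there is none. -/
noncomputable def move (c : Color) (x : V) : V :=
  if h : ∃ y, G.adj c x y then h.choose else x

theorem move_eq {c : Color} {x y : V} (h : G.adj c x y) : G.move c x = y := by
  have hex : ∃ y, G.adj c x y := ⟨y, h⟩
  rw [move, dif_pos hex]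
  exact G.proper hex.choose_spec h

theorem move_eq_self {c : Color} {x : V} (h : ¬ ∃ y, G.adj c x y) : G.move c x = x := by
  rw [move, dif_neg h]

theorem move_move (c : Color) (x : V) : G.move c (G.move c x) = x := by
  by_cases h : ∃ y, G.adj c x y
  · obtain ⟨y, hy⟩ := h
    rw [G.move_eq hy, G.move_eq (G.symm hy)]
  · rw [G.move_eq_self h, G.move_eq_self h]

/-- The vertex set of the ball of radius `r` around `x` for the path metric. -/
def ball (r : ℕ) (x : V) : Set V := {y | G.graph.edist x y ≤ r}

theorem mem_ball_self (r : ℕ) (x : V) : x ∈ G.ball r x := by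
  simp [ball]

theorem edist_le_one {x y : V} {c : Color} (h : G.adj c x y) : G.graph.edist x y ≤ 1 := by
  have ha : G.graph.Adj x y := ⟨c, h⟩
  have hw := SimpleGraph.edist_le (SimpleGraph.Walk.cons ha .nil)
  simpa using hw

theorem ball_step {r : ℕ} {x y z : V} {c : Color} (hy : y ∈ G.ball r x) (h : G.adj c y z) :
    z ∈ G.ball (r + 1) x := by
  have h1 := G.edist_le_one h
  have h2 : G.graph.edist x y ≤ r := hy
  have h3 := SimpleGraph.edist_triangle (G := G.graph) (u := x) (v := y) (w := z)
  change G.graph.edist x z ≤ ((r + 1 : ℕ) : ℕ∞)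
  push_cast
  exact h3.trans (add_le_add h2 h1)

theorem ball_subset_of_edist {r s : ℕ} {x y : V} (h : G.graph.edist x y ≤ s) :
    G.ball r y ⊆ G.ball (r + s) x := by
  intro z hz
  have h2 : G.graph.edist y z ≤ r := hz
  have h3 := SimpleGraph.edist_triangle (G := G.graph) (u := x) (v := y) (w := z)
  change G.graph.edist x z ≤ ((r + s : ℕ) : ℕ∞)
  push_cast
  rw [add_comm (r : ℕ∞)]
  exact h3.trans (add_le_add h h2)

theorem mem_ball_succ {r : ℕ} {x z : V} (hz : z ∈ G.ball (r + 1) x) :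
    z = x ∨ ∃ y ∈ G.ball r x, ∃ c, G.adj c y z := by
  have hz' : G.graph.edist x z ≤ ((r + 1 : ℕ) : ℕ∞) := hz
  obtain ⟨p, hp⟩ := SimpleGraph.exists_walk_of_edist_ne_top
    (ne_top_of_le_ne_top (ENat.natCast_ne_top _) hz')
  rw [← hp] at hz'
  have hl : p.length ≤ r + 1 := by exact_mod_cast hz'
  by_cases h0 : p.length = 0
  · left; exact (SimpleGraph.Walk.eq_of_length_eq_zero h0).symm
  · right
    have hnil : ¬ p.Nil := by
      rw [← SimpleGraph.Walk.length_eq_zero_iff] ; exact h0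
    refine ⟨p.penultimate, ?_, SimpleGraph.Walk.adj_penultimate hnil⟩
    have hle := SimpleGraph.edist_le p.dropLast
    refine hle.trans ?_
    have : p.dropLast.length ≤ r := by
      rw [SimpleGraph.Walk.dropLast, SimpleGraph.Walk.take_length]
      omega
    exact_mod_cast this

/-- `x` and `y` have the same `r`-type: there is a colour-preserving isomorphism of the spanned
subgraphs on the `r`-balls around `x` and `y` that maps `x` to `y`. -/
def SameType (r : ℕ) (x y : V) : Prop :=
  ∃ θ : G.ball r x ≃ G.ball r y,
    (∀ c u v, G.adj c (θ u : V) (θ v : V) ↔ G.adj c (u : V) (v : V)) ∧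
    (θ ⟨x, G.mem_ball_self r x⟩ : V) = y

theorem sameType_symm {r : ℕ} {x y : V} (h : G.SameType r x y) : G.SameType r y x := by
  obtain ⟨θ, h1, h2⟩ := h
  refine ⟨θ.symm, fun c u v => ?_, ?_⟩
  · rw [← h1 c (θ.symm u) (θ.symm v)]; simp
  · have : θ ⟨x, G.mem_ball_self r x⟩ = ⟨y, G.mem_ball_self r y⟩ := Subtype.ext h2
    rw [← this]; simp

theorem sameType_trans {r : ℕ} {x y z : V} (h : G.SameType r x y) (h' : G.SameType r y z) :
    G.SameType r x z := by
  obtain ⟨θ, h1, h2⟩ := h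
  obtain ⟨η, h3, h4⟩ := h'
  refine ⟨θ.trans η, fun c u v => ?_, ?_⟩
  · simp [h3, h1]
  · have : θ ⟨x, G.mem_ball_self r x⟩ = ⟨y, G.mem_ball_self r y⟩ := Subtype.ext h2
    simp [this, h4]

/-- Having the same `r`-type, as an equivalence relation on the vertices. -/
def typeSetoid (r : ℕ) : Setoid V where
  r := G.SameType r
  iseqv := ⟨fun _ => ⟨Equiv.refl _, by simp, rfl⟩, G.sameType_symm, G.sameType_trans⟩

/-- The set `U^r_G` of `r`-types that occur in `G`. -/
def RType (r : ℕ) : Type _ := Quotient (G.typeSetoid r)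

/-- The `r`-type of a vertex. -/
def rtype (r : ℕ) (x : V) : G.RType r := Quotient.mk (G.typeSetoid r) x

theorem iso_ball {R : ℕ} {x x' : V} (θ : G.ball R x ≃ G.ball R x')
    (hθ : ∀ c u v, G.adj c (θ u : V) (θ v : V) ↔ G.adj c (u : V) (v : V))
    (k : ℕ) (z : G.ball R x) (hsub : G.ball k (z : V) ⊆ G.ball R x) :
    ∀ w (hw : w ∈ G.ball k (z : V)), (θ ⟨w, hsub hw⟩ : V) ∈ G.ball k (θ z : V) := by
  induction k with
  | zero =>
    intro w hw
    have h0 : G.graph.edist (z : V) w ≤ ((0 : ℕ) : ℕ∞) := hw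
    have : (z : V) = w := by
      simpa using h0
    subst this
    exact G.mem_ball_self _ _
  | succ k ih =>
    intro w hw
    rcases G.mem_ball_succ hw with rfl | ⟨y, hy, c, hc⟩
    · exact G.mem_ball_self _ _
    · have hmono : G.ball k (z : V) ⊆ G.ball (k + 1) (z : V) := fun u hu =>
        le_trans (show G.graph.edist (z : V) u ≤ k from hu) (by push_cast; exact le_self_add)
      have h1 := ih (hmono.trans hsub) y hy
      refine G.ball_step h1 (c := c) ?_
      rw [hθ]
      exact hc

theorem sameType_of_iso {R k : ℕ} {x x' z z' : V} (θ : G.ball R x ≃ G.ball R x')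
    (hθ : ∀ c u v, G.adj c (θ u : V) (θ v : V) ↔ G.adj c (u : V) (v : V))
    (hsub : G.ball k z ⊆ G.ball R x) (hsub' : G.ball k z' ⊆ G.ball R x')
    (hz : (θ ⟨z, hsub (G.mem_ball_self k z)⟩ : V) = z') : G.SameType k z z' := by
  subst hz
  have hθ' : ∀ c u v, G.adj c (θ.symm u : V) (θ.symm v : V) ↔ G.adj c (u : V) (v : V) := by
    intro c u v
    rw [← hθ]; simp
  refine ⟨⟨fun w => ⟨θ ⟨w, hsub w.2⟩, ?_⟩, fun w => ⟨θ.symm ⟨w, hsub' w.2⟩, ?_⟩, ?_, ?_⟩, ?_, ?_⟩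
  · exact G.iso_ball θ hθ k ⟨z, hsub (G.mem_ball_self k z)⟩ hsub w w.2
  · have := G.iso_ball θ.symm hθ' k (θ ⟨z, hsub (G.mem_ball_self k z)⟩) hsub' w w.2
    simpa using this
  · intro w; ext; simp
  · intro w; ext; simp
  · intro c u v
    exact hθ c _ _
  · rfl

theorem sameType_move (c : Color) {r : ℕ} {x y : V} (h : G.SameType (r + 1) x y) :
    G.SameType r (G.move c x) (G.move c y) := by
  have key : ∀ u : V, G.graph.edist u (G.move c u) ≤ (1 : ℕ) := by
    intro u
    by_cases hu : ∃ v, G.adj c u v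
    · obtain ⟨v, hv⟩ := hu
      rw [G.move_eq hv]
      exact_mod_cast G.edist_le_one hv
    · rw [G.move_eq_self hu]; simp
  have hx := G.ball_subset_of_edist (r := r) (key x)
  have hy := G.ball_subset_of_edist (r := r) (key y)
  obtain ⟨θ, h1, h2⟩ := h
  have h2' : θ ⟨x, G.mem_ball_self _ x⟩ = ⟨y, G.mem_ball_self _ y⟩ := Subtype.ext h2
  refine G.sameType_of_iso θ h1 hx hy ?_
  by_cases hu : ∃ v, G.adj c x v
  · obtain ⟨v, hv⟩ := hu
    symm
    apply G.move_eq
    have hm : G.move c x = v := G.move_eq hv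
    have := (h1 c ⟨x, G.mem_ball_self _ x⟩ ⟨G.move c x, hx (G.mem_ball_self _ _)⟩).2
      (by simpa [hm] using hv)
    rwa [h2'] at this
  · have hv : ¬ ∃ v, G.adj c y v := by
      rintro ⟨v, hv⟩
      have hvm : v ∈ G.ball (r + 1) y := by
        have := G.move_eq hv
        rw [← this]
        exact hy (G.mem_ball_self _ _)
      apply hu
      refine ⟨θ.symm ⟨v, hvm⟩, ?_⟩
      have := (h1 c ⟨x, G.mem_ball_self _ x⟩ (θ.symm ⟨v, hvm⟩)).1
        (by rw [h2']; simpa using hv)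
      exact this
    have e1 : (⟨G.move c x, hx (G.mem_ball_self _ _)⟩ : G.ball (r + 1) x) =
        ⟨x, G.mem_ball_self _ x⟩ := Subtype.ext (G.move_eq_self hu)
    rw [e1, h2', G.move_eq_self hv]

theorem sameType_mono {r : ℕ} {x y : V} (h : G.SameType (r + 1) x y) : G.SameType r x y := by
  have hs : ∀ u : V, G.ball r u ⊆ G.ball (r + 1) u := fun u =>
    (G.ball_subset_of_edist (r := r) (s := 1) (x := u) (y := u) (by simp))
  obtain ⟨θ, h1, h2⟩ := h
  exact G.sameType_of_iso θ h1 (hs x) (hs y) h2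

/-- The `r`-type of `c · x` as a function of the `(r+1)`-type of `x`. -/
noncomputable def moveType (c : Color) (r : ℕ) : G.RType (r + 1) → G.RType r :=
  Quotient.map' (s₁ := G.typeSetoid (r + 1)) (s₂ := G.typeSetoid r) (G.move c)
    fun _ _ h => G.sameType_move c h

theorem moveType_rtype (c : Color) (r : ℕ) (x : V) :
    G.moveType c r (G.rtype (r + 1) x) = G.rtype r (G.move c x) := rfl

theorem rtype_surj {r : ℕ} (t : G.RType r) : ∃ x, G.rtype r x = t :=
  Quotient.exists_rep t

theorem rtype_mono {r : ℕ} {x y : V} (h : G.rtype (r + 1) x = G.rtype (r + 1) y) :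
    G.rtype r x = G.rtype r y :=
  Quotient.sound (s := G.typeSetoid r) (G.sameType_mono (Quotient.exact h))

/-! ### The type space and its action -/

/-- The type space `X_G`: chains `α_0 ≺ α_1 ≺ α_2 ≺ …` of types that occur in `G`, where the
`r`-ball around the root of `α_{r+1}` is of type `α_r`. (There is exactly one `0`-type, so that
starting the chains at `0` or at `1` makes no difference.) -/
structure TypeSpace where
  type : ∀ r, G.RType r
  chain : ∀ r, ∃ x, type (r + 1) = G.rtype (r + 1) x ∧ type r = G.rtype r x

variable {G}

theorem TypeSpace.chain' (α : G.TypeSpace) (r : ℕ) {x : V} (h : α.type (r + 1) = G.rtype (r + 1) x) :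
    α.type r = G.rtype r x := by
  obtain ⟨y, h1, h2⟩ := α.chain r
  rw [h2]
  exact G.rtype_mono (h1.symm.trans h)

theorem TypeSpace.ext' {α β : G.TypeSpace} (h : ∀ r, α.type r = β.type r) : α = β := by
  cases α; cases β
  congr
  exact funext h

variable (G)

/-- The action of the generator `c` on chains: if `α_{r+1}` is the type of `x`, then `(c · α)_r`
is the type of `c · x`. -/
noncomputable def moveChain (c : Color) (α : G.TypeSpace) : G.TypeSpace where
  type r := G.moveType c r (α.type (r + 1))
  chain r := by
    obtain ⟨x, hx⟩ := G.rtype_surj (α.type (r + 1 + 1))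
    refine ⟨G.move c x, ?_, ?_⟩
    · rw [← hx, G.moveType_rtype]
    · rw [α.chain' (r + 1) hx.symm, G.moveType_rtype]

theorem moveChain_moveChain (c : Color) (α : G.TypeSpace) :
    G.moveChain c (G.moveChain c α) = α := by
  apply TypeSpace.ext'
  intro r
  obtain ⟨x, hx⟩ := G.rtype_surj (α.type (r + 1 + 1))
  have h2 := α.chain' (r + 1) hx.symm
  change G.moveType c r (G.moveType c (r + 1) (α.type (r + 1 + 1))) = α.type r
  rw [← hx, moveType_rtype, moveType_rtype, move_move, α.chain' r h2]

/-- The permutation of the type space given by the generator `c`. -/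
noncomputable def movePerm (c : Color) : Equiv.Perm G.TypeSpace :=
  ⟨G.moveChain c, G.moveChain c, G.moveChain_moveChain c, G.moveChain_moveChain c⟩

/-- The action of `Γ` on the type space. -/
noncomputable def typeAction : Gam →* Equiv.Perm G.TypeSpace :=
  homOfInvolutions G.movePerm fun c => Equiv.ext fun α => G.moveChain_moveChain c α

noncomputable instance : MulAction Gam G.TypeSpace :=
  MulAction.compHom G.TypeSpace G.typeAction

end ColoredGraph

/-! ### Schreier graphs and amenability -/

/-- The Schreier graph of an action (without its loops) for a set `S` of group elements. -/
def schreierGraph {Γ : Type*} [Group Γ] (S : Set Γ) (X : Type*) [MulAction Γ X] : SimpleGraph X :=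
  SimpleGraph.fromRel fun x y => ∃ s ∈ S, x = s • y

/-- The leaf through `α`: the Schreier graph of the orbit of `α` for the generators
`A, B, C, D`. -/
noncomputable def leaf {V : Type*} (G : ColoredGraph V) (α : G.TypeSpace) :
    SimpleGraph (MulAction.orbit Gam α) :=
  schreierGraph (Set.range gen) (MulAction.orbit Gam α)

/-- Amenability of a graph: finite nonempty vertex sets with arbitrarily small relative
inner boundary. -/
def IsAmenableGraph {V : Type*} (G : SimpleGraph V) : Prop :=
  ∀ ε : ℝ, 0 < ε → ∃ Ω : Finset V, Ω.Nonempty ∧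
    (({x : V | x ∈ Ω ∧ ∃ y, y ∉ Ω ∧ G.Adj x y}.ncard : ℕ) : ℝ) / (Ω.card : ℝ) < ε

/-! ### The words attached in the construction -/

/-- The reduced words of length `k + 1`, written from left to right, in lexicographic order. -/
def wordsOfLength : ℕ → List (List Color)
  | 0 => [[Color.A], [Color.B], [Color.C], [Color.D]]
  | k + 1 => [Color.A, Color.B, Color.C, Color.D].flatMap fun c =>
      ((wordsOfLength k).filter fun w => decide (w.head? ≠ some c)).map fun w => c :: w

/-- The `n`-th word (`n ≥ 1`) in the list `A, B, C, D, AB, AC, AD, BA, …` of all nonempty reduced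
words, ordered by length and then lexicographically. -/
def nthWord (n : ℕ) : List Color :=
  ((List.range n).flatMap wordsOfLength).getD (n - 1) []

/-- The colours along the path attached for the word `w = w_k ⋯ w_1`, the letters being given in
the order `w_1, …, w_k`: a `D`-edge followed by `w_1, …, w_k`, the extra `D` being omitted if
`w_1 = D`. -/
def pathColors (w : List Color) : List Color :=
  if w.head? = some Color.D then w else Color.D :: w

theorem wordsOfLength_chain (k : ℕ) : ∀ w ∈ wordsOfLength k, w.IsChain (· ≠ ·) := by
  induction k with
  | zero => intro w hw; simp [wordsOfLength] at hw; rcases hw with rfl | rfl | rfl | rfl <;> simp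
  | succ k ih =>
    intro w hw
    simp only [wordsOfLength, List.mem_flatMap, List.mem_map, List.mem_filter] at hw
    obtain ⟨c, -, v, ⟨hv, hc⟩, rfl⟩ := hw
    have hv' := ih v hv
    rw [List.isChain_cons]
    refine ⟨fun y hy => ?_, hv'⟩
    intro h
    subst h
    simp at hc
    exact hc hy

theorem nthWord_chain (n : ℕ) : (nthWord n).IsChain (· ≠ ·) := by
  rw [nthWord, List.getD_eq_getElem?_getD]
  cases h : ((List.range n).flatMap wordsOfLength)[n - 1]? with
  | none => simp
  | some w =>
    have := List.mem_of_getElem? h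
    simp only [List.mem_flatMap] at this
    obtain ⟨k, -, hk⟩ := this
    exact wordsOfLength_chain k w hk

theorem pathColors_chain {w : List Color} (h : w.IsChain (· ≠ ·)) :
    (pathColors w).IsChain (· ≠ ·) := by
  unfold pathColors
  split_ifs with h0
  · exact h
  · rw [List.isChain_cons]
    refine ⟨fun y hy hy' => ?_, h⟩
    subst hy'
    exact h0 hy

/-! ### The main construction -/

/-- The cycle of length `2 * i`, with edges coloured alternately by `A` and `B`. -/
def cycleAdj (i : ℕ) (c : Color) (x y : ZMod i × Bool) : Prop :=
  (c = Color.A ∧ x.1 = y.1 ∧ x.2 ≠ y.2) ∨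
  (c = Color.B ∧ ((x.2 = true ∧ y.2 = false ∧ y.1 = x.1 + 1) ∨
    (y.2 = true ∧ x.2 = false ∧ x.1 = y.1 + 1)))

/-- The Cayley graph of `Γ̃ / N` with respect to `A, B, C`. -/
def cayleyAdj (N : Subgroup GamTilde) (c : Color) (x y : GamTilde ⧸ N) : Prop :=
  c ≠ Color.D ∧ ∃ g : GamTilde, (g : Gam) = gen c ∧ y = g • x

/-- A finite properly `4`-coloured graph with a marked vertex `r` at which no edge of colour `D`
ends. The graphs `G_n` are of this kind; later copies are attached at `r` by an edge of
colour `D`. -/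
structure Stage where
  V : Type
  finite : Finite V
  G : ColoredGraph V
  r : V
  free : ∀ y, ¬ G.adj Color.D r y

/-- Colour-preserving isomorphisms respecting the marked vertices. -/
structure Stage.Iso (S T : Stage) where
  equiv : S.V ≃ T.V
  adj_iff : ∀ c u v, T.G.adj c (equiv u) (equiv v) ↔ S.G.adj c u v
  map_r : equiv S.r = T.r

/-- `G_0`: a single vertex. -/
def stageZero : Stage where
  V := Unit
  finite := inferInstance
  G := ⟨fun _ _ _ => False, id, id, fun h => h.elim, fun h => h.elim⟩
  r := ()
  free := fun _ => id

/-- The edges of `G_1`: a triangle with vertices `0, 1, 2` and edges of colours `A, B, C`, and an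
edge of colour `D` from the vertex `q` of the triangle to `p = none`. -/
inductive StageOneAdj (q : Fin 3) : Color → Option (Fin 3) → Option (Fin 3) → Prop
  | a : StageOneAdj q Color.A (some 0) (some 1)
  | b : StageOneAdj q Color.B (some 1) (some 2)
  | c : StageOneAdj q Color.C (some 2) (some 0)
  | d : StageOneAdj q Color.D (some q) none

/-- `G_1`, with marked vertex `r_1 ≠ q` in the triangle. -/
def stageOne (q r : Fin 3) (h : r ≠ q) : Stage where
  V := Option (Fin 3)
  finite := inferInstance
  G :=
    { adj := fun c x y => StageOneAdj q c x y ∨ StageOneAdj q c y x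
      symm := Or.symm
      irrefl := by rintro c x (h | h) <;> cases h
      color_unique := by rintro c c' x y (h | h) (h' | h') <;> cases h <;> cases h' <;> rfl
      proper := by rintro c x y z (h | h) (h' | h') <;> cases h <;> cases h' <;> rfl }
  r := some r
  free := by
    rintro y (h' | h')
    · cases h'; exact h rfl
    · cases h'

/-- The numbers `s_{j+1} = m^{j+1} 2^{|V(G_j)|}`. -/
noncomputable def netScale (m : ℕ) (K : ℕ → Stage) (j : ℕ) : ℕ :=
  m ^ (j + 1) * 2 ^ Nat.card (K j).V

/-- The choices made in step `n + 1` of the construction (`n ≥ 1`), after the graphs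
`G_0, …, G_n` (here `K 0, …, K n`) have been constructed. -/
structure StepChoice (m : ℕ) (N : ℕ → Subgroup GamTilde) (K : ℕ → Stage) (n : ℕ) where
  /-- The vertices of the graph `H_{n+1}`. -/
  W : Type
  finite : Finite W
  /-- The graph `H_{n+1}`. -/
  H : ColoredGraph W
  /-- In even steps it is an `A, B`-coloured cycle of even length. -/
  even : Even (n + 1) → ∃ i : ℕ, 0 < i ∧ ∃ e : W ≃ ZMod i × Bool,
    ∀ c u v, H.adj c u v ↔ cycleAdj i c (e u) (e v)
  /-- In odd steps it is the Cayley graph of one of the finite groups `Γ̃ / N_i`. -/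
  odd : Odd (n + 1) → ∃ i : ℕ, ∃ e : W ≃ GamTilde ⧸ N i,
    ∀ c u v, H.adj c u v ↔ cayleyAdj (N i) c (e u) (e v)
  diam_le : 10 * netScale m K n ≤ H.graph.diam
  /-- The partition of the vertices of `H_{n+1}` into `n + 2` parts: the part `R^{n+1}_{j+1}` is
  the set of all `u` with `part u = j`. -/
  part : W → ℕ
  part_le : ∀ u, part u ≤ n + 1
  /-- `R^{n+1}_{j+1}` is a `2 s_{j+1}`-net for `j ≤ n`. -/
  net : ∀ u v, u ≠ v → part u = part v → part u ≤ n →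
    2 * netScale m K (part u) ≤ H.graph.dist u v
  /-- Each vertex is at distance at most `10 s_{j+1}` from `R^{n+1}_{j+1}`, for `j ≤ n`. -/
  dense : ∀ j ≤ n, ∀ u, ∃ v, part v = j ∧ H.graph.dist v u ≤ 10 * netScale m K j
  /-- The vertex of `R^{n+1}_{n+1}` to which `G_n` is attached. -/
  a : W
  part_a : part a = n
  /-- The vertex `x_{n+1}` to which a path is attached. -/
  x : W
  part_x : part x = n + 1
  /-- The vertex `r_{n+1}`. -/
  r : W
  part_r : part r = n + 1
  r_ne_x : r ≠ x
  /-- The index of the word that is used. -/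
  idx : ℕ
  idx_eq : idx = n ∨ idx = n + 1

namespace StepChoice

variable {m : ℕ} {N : ℕ → Subgroup GamTilde} {K : ℕ → Stage} {n : ℕ}

/-- The colours of the attached path; the word is read from right to left. -/
def colors (s : StepChoice m N K n) : List Color := pathColors (nthWord s.idx).reverse

theorem colors_chain (s : StepChoice m N K n) : s.colors.IsChain (· ≠ ·) := by
  apply pathColors_chain
  rw [List.isChain_reverse]
  refine List.IsChain.imp ?_ (nthWord_chain s.idx)
  intro a b h
  exact Ne.symm h

theorem H_noD (s : StepChoice m N K n) (u v : s.W) : ¬ s.H.adj Color.D u v := by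
  intro h
  rcases Nat.even_or_odd (n + 1) with hn | hn
  · obtain ⟨i, -, e, he⟩ := s.even hn
    have h' := (he _ _ _).1 h
    rcases h' with h' | h'
    · exact absurd h'.1 (by decide)
    · exact absurd h'.1 (by decide)
  · obtain ⟨i, e, he⟩ := s.odd hn
    exact ((he _ _ _).1 h).1 rfl

/-- The vertices of `G_{n+1}`: those of `H_{n+1}`; those of a copy of `G_j` for each vertex of
`R^{n+1}_{j+1}`, for all `j < n`; those of `G_n`; and those of the path. -/
inductive Vertex (s : StepChoice m N K n) : Type
  | core (u : s.W)
  | copy (u : s.W) (hu : s.part u < n) (v : (K (s.part u)).V)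
  | old (v : (K n).V)
  | path (i : Fin s.colors.length)

/-- The edges of `G_{n+1}`, each in at least one of its two directions. -/
inductive Edge (s : StepChoice m N K n) : Color → s.Vertex → s.Vertex → Prop
  | core {c : Color} {u v : s.W} : s.H.adj c u v → Edge s c (.core u) (.core v)
  | copy {c : Color} {u : s.W} {hu : s.part u < n} {v w : (K (s.part u)).V} :
      (K (s.part u)).G.adj c v w → Edge s c (.copy u hu v) (.copy u hu w)
  | old {c : Color} {v w : (K n).V} : (K n).G.adj c v w → Edge s c (.old v) (.old w)
  | path {c : Color} {i j : Fin s.colors.length} :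
      (j : ℕ) = i + 1 → c = s.colors.get j → Edge s c (.path i) (.path j)
  | linkCopy {u : s.W} {hu : s.part u < n} {v : (K (s.part u)).V} :
      v = (K (s.part u)).r → Edge s Color.D (.core u) (.copy u hu v)
  | linkOld {u : s.W} {v : (K n).V} :
      u = s.a → v = (K n).r → Edge s Color.D (.core u) (.old v)
  | linkPath {u : s.W} {i : Fin s.colors.length} :
      u = s.x → (i : ℕ) = 0 → Edge s Color.D (.core u) (.path i)

theorem colors_zero (s : StepChoice m N K n) {i : Fin s.colors.length} (hi : (i : ℕ) = 0) :
    s.colors.get i = Color.D := by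
  have key : ∀ (w : List Color) (h : 0 < (pathColors w).length), (pathColors w)[0] = Color.D := by
    intro w
    unfold pathColors
    split_ifs with h0
    · intro _
      cases w with
      | nil => cases h0
      | cons b t => simpa using h0
    · simp
  obtain ⟨i, h⟩ := i
  subst hi
  exact key _ h

theorem colors_succ (s : StepChoice m N K n) {i j : Fin s.colors.length} (h : (j : ℕ) = i + 1) :
    s.colors.get j ≠ s.colors.get i := by
  have := List.isChain_iff_getElem.1 s.colors_chain i (by have := j.2; omega)
  obtain ⟨j, hj⟩ := j
  simp only at h
  subst h
  exact Ne.symm this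

/-- The properly coloured graph `G_{n+1}`. -/
def graph (s : StepChoice m N K n) : ColoredGraph s.Vertex where
  adj c x y := s.Edge c x y ∨ s.Edge c y x
  symm := Or.symm
  irrefl := by
    rintro c x (h | h)
    · cases h with
      | core h => exact s.H.irrefl h
      | copy h => exact (K _).G.irrefl h
      | old h => exact (K _).G.irrefl h
      | path h => omega
    · cases h with
      | core h => exact s.H.irrefl h
      | copy h => exact (K _).G.irrefl h
      | old h => exact (K _).G.irrefl h
      | path h => omega
  color_unique := by
    have f1 := s.H_noD
    have f2 := fun j => (K j).free
    have f3 := s.part_a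
    have f4 := s.part_x
    have f5 := fun c x y => @ColoredGraph.symm _ s.H c x y
    have f6 := fun j c x y => @ColoredGraph.symm _ (K j).G c x y
    have f7 := fun i => @colors_zero _ _ _ _ s i
    have f8 := fun i j => @colors_succ _ _ _ _ s i j
    have g1 := fun c c' x y => @ColoredGraph.color_unique _ s.H c c' x y
    have g2 := fun j c c' x y => @ColoredGraph.color_unique _ (K j).G c c' x y
    rintro c c' x y (h | h) (h' | h') <;> cases h <;> cases h' <;> grind
  proper := by
    have f1 := s.H_noD
    have f2 := fun j => (K j).free
    have f3 := s.part_a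
    have f4 := s.part_x
    have f5 := fun c x y => @ColoredGraph.symm _ s.H c x y
    have f6 := fun j c x y => @ColoredGraph.symm _ (K j).G c x y
    have f7 := fun i => @colors_zero _ _ _ _ s i
    have f8 := fun i j => @colors_succ _ _ _ _ s i j
    have g1 := fun c x y z => @ColoredGraph.proper _ s.H c x y z
    have g2 := fun j c x y z => @ColoredGraph.proper _ (K j).G c x y z
    rintro c x y z (h | h) (h' | h') <;> cases h <;> cases h' <;> grind

instance (s : StepChoice m N K n) : Finite s.Vertex := by
  have := s.finite
  have : ∀ j, Finite (K j).V := fun j => (K j).finite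
  let f : s.Vertex → s.W ⊕ (Σ u : s.W, (K (s.part u)).V) ⊕ (K n).V ⊕ Fin s.colors.length
    | .core u => Sum.inl u
    | .copy u _ v => Sum.inr (Sum.inl ⟨u, v⟩)
    | .old v => Sum.inr (Sum.inr (Sum.inl v))
    | .path i => Sum.inr (Sum.inr (Sum.inr i))
  refine Finite.of_injective f ?_
  rintro (u | ⟨u, hu, v⟩ | v | i) (u' | ⟨u', hu', v'⟩ | v' | i') h <;> simp [f] at h
  · rw [h]
  · obtain ⟨rfl, h⟩ := h
    rw [eq_of_heq h]
  · rw [h]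
  · rw [h]

/-- The graph `G_{n+1}` with its marked vertex. -/
def next (s : StepChoice m N K n) : Stage where
  V := s.Vertex
  finite := inferInstance
  G := s.graph
  r := .core s.r
  free := by
    rintro y (h | h)
    · cases h with
      | core h => exact s.H_noD _ _ h
      | @linkCopy _ hu => rw [s.part_r] at hu; omega
      | linkOld h =>
        have h1 := s.part_r
        rw [h, s.part_a] at h1; omega
      | linkPath h => exact s.r_ne_x h
    · cases h with
      | core h => exact s.H_noD _ _ h

end StepChoice

/-- `G` is (up to isomorphism) a graph obtained by the main construction with parameter `m` and
the normal subgroups `N i`: the graphs `G_0, G_1, …` are obtained successively, and `G` is the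
union of the increasing sequence `G_0 ⊆ G_1 ⊆ …`. -/
structure MainConstruction (m : ℕ) (N : ℕ → Subgroup GamTilde) {V : Type*}
    (G : ColoredGraph V) where
  /-- The graphs `G_n`. -/
  K : ℕ → Stage
  zero : stageZero.Iso (K 0)
  q : Fin 3
  r : Fin 3
  r_ne_q : r ≠ q
  one : (stageOne q r r_ne_q).Iso (K 1)
  step : ∀ n, 1 ≤ n → StepChoice m N K n
  succ : ∀ n (hn : 1 ≤ n), (step n hn).next.Iso (K (n + 1))
  /-- The inclusion of `G_n` in `G`. -/
  incl : ∀ n, (K n).V → V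
  incl_injective : ∀ n, Function.Injective (incl n)
  incl_adj : ∀ n c u v, G.adj c (incl n u) (incl n v) ↔ (K n).G.adj c u v
  /-- `G_0 ⊆ G_1` is the vertex `p`. -/
  incl_zero : ∀ v, incl 0 v = incl 1 (one.equiv (none : Option (Fin 3)))
  incl_succ : ∀ n (hn : 1 ≤ n) (v : (K n).V),
    incl n v = incl (n + 1) ((succ n hn).equiv (StepChoice.Vertex.old v))
  exhaust : ∀ x, ∃ n v, incl n v = x

end TypeSpaceAction

/-! A stage `G_i` sits inside every later stage, and in `G`, through maps that commute with all
moves except possibly `D` at the marked vertex, since a copy is left only through that one edge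
(`Stage.Equivariant`). A large finite piece with at most one exit is nearly a Følner set, so it
suffices to find such pieces in every leaf.

The nets provide them. For fixed `i`, every core vertex of a late stage is within `10 * netScale m K
i + 1` moves of the marked vertex of a copy of `G_i`, a bound that does not depend on the stage.
Vertices in copies of later stages are handled by recursion, and those in copies of early stages
reach a core in boundedly many moves. Only a vertex deep inside an attached path can be far from all
copies, and there the graph has degree at most two. This is `near_copy_or_path`.

Fix a chain `α`. If vertices approximating `α` to arbitrary depth see degree at most two in
arbitrarily large balls, the whole leaf has degree at most two and is amenable, because a connected
set grown one vertex at a time keeps at most two exits (`isAmenableGraph_of_atMostTwoMoves`).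
Otherwise, for each `i`, good approximations of `α` lie at bounded distance from a copy of `G_i`.
Relations between words visible in a ball hold in the leaf (`TypeSpace.follow_eq`), so the copy maps
to the leaf. The leaf may identify points that differ in `G`, so the map need not be injective. But
if its image does not contain the exit, the map is injective and the image has at least `i` points
and at most one boundary point; if it does contain the exit, the image is closed under all moves
(`exists_finset_of_copy`). -/

namespace TypeSpaceAction

/-! ### Following words -/

/-- Apply the moves given by the letters of `w`, from left to right. -/
def follow {X : Type*} (m : Color → X → X) (w : List Color) (x : X) : X :=
  w.foldl (fun y c => m c y) x

section Follow

variable {X : Type*} (m : Color → X → X)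

@[simp] theorem follow_nil (x : X) : follow m [] x = x := rfl

@[simp] theorem follow_cons (c : Color) (w : List Color) (x : X) :
    follow m (c :: w) x = follow m w (m c x) := rfl

theorem follow_append (w w' : List Color) (x : X) :
    follow m (w ++ w') x = follow m w' (follow m w x) := by
  simp [follow, List.foldl_append]

theorem follow_reverse (hm : ∀ c x, m c (m c x) = x) (w : List Color) (x : X) :
    follow m w.reverse (follow m w x) = x := by
  induction w generalizing x with
  | nil => rfl
  | cons c w ih => 
    rw [List.reverse_cons, follow_append, follow_cons m c w, ih]
    exact hm c x

end Follow

/-! ### Amenability criteria -/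

theorem gen_mul_gen (c : Color) : gen c * gen c = 1 := by
  rw [gen, ← map_mul, ← ofAdd_add]
  have : (1 : ZMod 2) + 1 = 0 := by decide
  rw [this, ofAdd_zero, map_one]

theorem gen_smul_gen_smul {X : Type*} [MulAction Gam X] (c : Color) (x : X) :
    gen c • gen c • x = x := by
  rw [smul_smul, gen_mul_gen, one_smul]

theorem schreierGraph_adj {X : Type*} [MulAction Gam X] {x y : X}
    (h : (schreierGraph (Set.range gen) X).Adj x y) : ∃ c, y = gen c • x := by
  rw [schreierGraph, SimpleGraph.fromRel_adj] at h
  obtain ⟨-, ⟨_, ⟨c, rfl⟩, h⟩ | ⟨_, ⟨c, rfl⟩, h⟩⟩ := h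
  · exact ⟨c, by rw [h, gen_smul_gen_smul]⟩
  · exact ⟨c, h⟩

/-- A Schreier graph is amenable if it has arbitrarily large finite sets with at most two boundary
points, or a nonempty finite set without boundary. -/
theorem isAmenableGraph_of_boundary {X : Type*} [MulAction Gam X]
    (h : ∀ n : ℕ, ∃ Ω : Finset X, Ω.Nonempty ∧ ((∀ x ∈ Ω, ∀ c, gen c • x ∈ Ω) ∨
      n ≤ Ω.card ∧ ∃ a b, ∀ x ∈ Ω, ∀ c, gen c • x ∉ Ω → x = a ∨ x = b)) :
    IsAmenableGraph (schreierGraph (Set.range gen) X) := by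
  intro ε hε
  obtain ⟨n, hn⟩ := exists_nat_gt (2 / ε)
  obtain ⟨Ω, hne, hΩ⟩ := h n
  refine ⟨Ω, hne, ?_⟩
  have hpos : (0 : ℝ) < Ω.card := by exact_mod_cast hne.card_pos
  rw [div_lt_iff₀ hpos]
  rcases hΩ with hΩ | ⟨hcard, a, b, hab⟩
  · have : {x : X | x ∈ Ω ∧ ∃ y, y ∉ Ω ∧ (schreierGraph (Set.range gen) X).Adj x y} = ∅ := by
      ext x
      simp only [Set.mem_ofPred_eq, Set.mem_empty_iff_false, iff_false]
      rintro ⟨hx, y, hy, hxy⟩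
      obtain ⟨c, rfl⟩ := schreierGraph_adj hxy
      exact hy (hΩ x hx c)
    rw [this]
    simpa using mul_pos hε hpos
  · have hsub : {x : X | x ∈ Ω ∧ ∃ y, y ∉ Ω ∧ (schreierGraph (Set.range gen) X).Adj x y} ⊆
        {a, b} := by
      rintro x ⟨hx, y, hy, hxy⟩
      obtain ⟨c, rfl⟩ := schreierGraph_adj hxy
      exact hab x hx c hy
    have h2 := (Set.ncard_le_ncard hsub (Set.toFinite _)).trans (Set.ncard_insert_le a {b})
    rw [Set.ncard_singleton] at h2
    have h3 : (2 : ℝ) < ε * n := by rwa [div_lt_iff₀' hε] at hn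
    have h4 : ε * n ≤ ε * Ω.card := by gcongr
    have h5 : (({x : X | x ∈ Ω ∧ ∃ y, y ∉ Ω ∧
        (schreierGraph (Set.range gen) X).Adj x y}.ncard : ℕ) : ℝ) ≤ 2 := by exact_mod_cast h2
    linarith

/-- At most two of the four moves are nontrivial at `x`. -/
def AtMostTwoMoves {X : Type*} (m : Color → X → X) (x : X) : Prop :=
  ∃ c₁ c₂, ∀ c, c ≠ c₁ → c ≠ c₂ → m c x = x

theorem AtMostTwoMoves.exists_other {X : Type*} {m : Color → X → X} {x : X}
    (h : AtMostTwoMoves m x) {c : Color} (hc : m c x ≠ x) :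
    ∃ c', ∀ d, d ≠ c → d ≠ c' → m d x = x := by
  obtain ⟨c₁, c₂, h⟩ := h
  by_cases h1 : c = c₁
  · exact ⟨c₂, fun d hd hd' => h d (h1 ▸ hd) hd'⟩
  · by_cases h2 : c = c₂
    · exact ⟨c₁, fun d hd hd' => h d hd' (h2 ▸ hd)⟩
    · exact absurd (h c h1 h2) hc

open Classical in
/-- A Schreier graph of degree at most two is amenable. -/
theorem isAmenableGraph_of_atMostTwoMoves {X : Type*} [MulAction Gam X] [Nonempty X]
    (h : ∀ x : X, AtMostTwoMoves (fun c y => gen c • y) x) :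
    IsAmenableGraph (schreierGraph (Set.range gen) X) := by
  by_cases hfin : ∃ Ω : Finset X, Ω.Nonempty ∧ ∀ x ∈ Ω, ∀ c, gen c • x ∈ Ω
  · obtain ⟨Ω, h1, h2⟩ := hfin
    exact isAmenableGraph_of_boundary fun n => ⟨Ω, h1, Or.inl h2⟩
  -- The count is of exits, that is pairs (vertex, colour) leading out of `Ω`. Adding the endpoint
  -- of one exit removes that exit and creates at most one new one.
  have key : ∀ n : ℕ, ∃ Ω : Finset X, Ω.card = n + 1 ∧ ∃ p q : X × Color,
      ∀ x ∈ Ω, ∀ c, gen c • x ∉ Ω → (x, c) = p ∨ (x, c) = q := by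
    intro n
    induction n with
    | zero =>
      obtain ⟨x⟩ := ‹Nonempty X›
      obtain ⟨c₁, c₂, hx⟩ := h x
      refine ⟨{x}, by simp, (x, c₁), (x, c₂), fun y hy c hc => ?_⟩
      rw [Finset.mem_singleton] at hy hc
      subst hy
      by_contra! hcon
      exact hc (hx c (fun e => hcon.1 (by rw [e])) (fun e => hcon.2 (by rw [e])))
    | succ n ih =>
      obtain ⟨Ω, hcard, p, q, hpq⟩ := ih
      have hne : Ω.Nonempty := Finset.card_pos.1 (by omega)
      obtain ⟨x, hx, c, hc⟩ : ∃ x ∈ Ω, ∃ c, gen c • x ∉ Ω := by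
        by_contra! hcon
        exact hfin ⟨Ω, hne, hcon⟩
      obtain ⟨q', hq'⟩ : ∃ q', ∀ y ∈ Ω, ∀ d, gen d • y ∉ Ω → (y, d) = (x, c) ∨ (y, d) = q' := by
        rcases hpq x hx c hc with e | e
        · exact ⟨q, fun y hy d hd => e ▸ hpq y hy d hd⟩
        · exact ⟨p, fun y hy d hd => e ▸ (hpq y hy d hd).symm⟩
      have hback : gen c • gen c • x = x := gen_smul_gen_smul c x
      -- The move back into `Ω` is one of the at most two nontrivial moves at the new vertex, which
      -- leaves one colour `c'` for a new exit.
      have hmove : gen c • gen c • x ≠ gen c • x := by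
        rw [hback]
        intro e
        exact hc (e ▸ hx)
      obtain ⟨c', hc'⟩ := (h (gen c • x)).exists_other hmove
      refine ⟨insert (gen c • x) Ω, by rw [Finset.card_insert_of_notMem hc, hcard],
        (gen c • x, c'), q', fun y hy d hd => ?_⟩
      rw [Finset.mem_insert, not_or] at hd
      rcases Finset.mem_insert.1 hy with rfl | hy
      · left
        by_contra hcon
        by_cases hdc : d = c
        · subst hdc
          exact hd.2 (hback.symm ▸ hx)
        · exact hd.1 (hc' d hdc fun e => hcon (by rw [e]))
      · rcases hq' y hy d hd.2 with e | e
        · cases e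
          exact absurd rfl hd.1
        · exact Or.inr e
  refine isAmenableGraph_of_boundary fun n => ?_
  obtain ⟨Ω, hcard, p, q, hpq⟩ := key n
  refine ⟨Ω, Finset.card_pos.1 (by omega), Or.inr ⟨by omega, p.1, q.1, fun x hx c hc => ?_⟩⟩
  rcases hpq x hx c hc with e | e
  · exact Or.inl (by rw [← e])
  · exact Or.inr (by rw [← e])

/-! ### Words and types -/

theorem typeAction_gen {V : Type*} (G : ColoredGraph V) (c : Color) (α : G.TypeSpace) :
    gen c • α = G.moveChain c α := by
  change G.typeAction (gen c) α = _
  rw [ColoredGraph.typeAction, homOfInvolutions, gen, Monoid.CoprodI.lift_of]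
  change ((G.movePerm c) ^ (1 : ZMod 2).val) α = _
  rw [show (1 : ZMod 2).val = 1 from rfl, pow_one]
  rfl

theorem coe_follow {V : Type*} (G : ColoredGraph V) {α : G.TypeSpace} (w : List Color)
    (β : MulAction.orbit Gam α) :
    ((follow (fun c (y : MulAction.orbit Gam α) => gen c • y) w β : MulAction.orbit Gam α) :
      G.TypeSpace) = follow G.moveChain w β := by
  induction w generalizing β with
  | nil => rfl
  | cons c w ih =>
    rw [follow_cons, ih, follow_cons, MulAction.orbit.coe_smul, typeAction_gen]

theorem exists_follow_of_mem_orbit {V : Type*} (G : ColoredGraph V) {α β : G.TypeSpace}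
    (hβ : β ∈ MulAction.orbit Gam α) : ∃ w, β = follow G.moveChain w α := by
  obtain ⟨γ, rfl⟩ := hβ
  change ∃ w, γ • α = _
  have key : ∀ (γ : Gam) (δ : G.TypeSpace), ∃ w, γ • δ = follow G.moveChain w δ := by
    intro γ
    induction γ using Monoid.CoprodI.induction_on with
    | one => exact fun δ => ⟨[], one_smul _ _⟩
    | of c z =>
      intro δ
      have hz : z = 1 ∨ z = Multiplicative.ofAdd 1 := by
        revert z; decide
      rcases hz with rfl | rfl
      · exact ⟨[], by rw [map_one, one_smul]; rfl⟩
      · exact ⟨[c], typeAction_gen G c δ⟩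
    | mul a b ha hb =>
      intro δ
      obtain ⟨w, hw⟩ := hb δ
      obtain ⟨w', hw'⟩ := ha (b • δ)
      exact ⟨w ++ w', by rw [follow_append, ← hw, ← hw', smul_smul]⟩
  exact key γ α

namespace ColoredGraph

variable {V : Type*} (G : ColoredGraph V)

theorem move_mem_ball {k : ℕ} {x z : V} (hz : z ∈ G.ball k x) (c : Color) :
    G.move c z ∈ G.ball (k + 1) x := by
  by_cases h : ∃ v, G.adj c z v
  · obtain ⟨v, hv⟩ := h
    rw [G.move_eq hv]
    exact G.ball_step hz hv
  · rw [G.move_eq_self h]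
    exact le_trans (show G.graph.edist x z ≤ k from hz) (by push_cast; exact le_self_add)

theorem ball_mono {k R : ℕ} (h : k ≤ R) (x : V) : G.ball k x ⊆ G.ball R x := fun u hu =>
  le_trans (show G.graph.edist x u ≤ k from hu) (by exact_mod_cast h)

/-- An isomorphism of balls sees an edge only if both ends lie in the ball. Hence `z` and its image
are both kept one step away from the rim, so that an edge on either side transfers to the other. -/
theorem iso_move {R k : ℕ} {x y : V} (θ : G.ball R x ≃ G.ball R y)
    (hθ : ∀ c u v, G.adj c (θ u : V) (θ v : V) ↔ G.adj c (u : V) (v : V))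
    (hk : k + 1 ≤ R) (c : Color) (z : G.ball R x) (hz : (z : V) ∈ G.ball k x)
    (hz' : (θ z : V) ∈ G.ball k y) :
    (θ ⟨G.move c z, G.ball_mono hk x (G.move_mem_ball hz c)⟩ : V) = G.move c (θ z) := by
  by_cases h : ∃ v, G.adj c z v
  · obtain ⟨v, hv⟩ := h
    symm
    apply G.move_eq
    rw [hθ]
    change G.adj c z (G.move c z)
    rw [G.move_eq hv]
    exact hv
  · have h' : ¬ ∃ v, G.adj c (θ z) v := by
      rintro ⟨v, hv⟩
      refine h ⟨θ.symm ⟨v, G.ball_mono hk y (G.ball_step hz' hv)⟩, ?_⟩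
      rw [← hθ]
      simpa using hv
    rw [G.move_eq_self h']
    congr 2
    exact Subtype.ext (G.move_eq_self h)

theorem exists_iso_follow {R : ℕ} {x y : V} (h : G.SameType R x y) :
    ∃ f : G.ball R x ≃ G.ball R y, ∀ w : List Color, w.length ≤ R →
      ∃ hw : follow G.move w x ∈ G.ball R x, (f ⟨_, hw⟩ : V) = follow G.move w y := by
  obtain ⟨θ, hθ, hx⟩ := h
  refine ⟨θ, ?_⟩
  have key : ∀ (w : List Color) (k : ℕ) (z : G.ball R x), k + w.length ≤ R →
      (z : V) ∈ G.ball k x → (θ z : V) ∈ G.ball k y →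
      ∃ hw : follow G.move w z ∈ G.ball R x, (θ ⟨_, hw⟩ : V) = follow G.move w (θ z) := by
    intro w
    induction w with
    | nil => exact fun k z _ _ _ => ⟨z.2, rfl⟩
    | cons c w ih =>
      intro k z hk hz hz'
      rw [List.length_cons] at hk
      have e := G.iso_move θ hθ (k := k) (by omega) c z hz hz'
      obtain ⟨h1, h2⟩ := ih (k + 1) ⟨G.move c z, _⟩ (by omega) (G.move_mem_ball hz c)
        (by rw [e]; exact G.move_mem_ball hz' c)
      exact ⟨h1, h2.trans (congrArg (follow G.move w) e)⟩
  intro w hw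
  obtain ⟨h1, h2⟩ := key w 0 ⟨x, G.mem_ball_self R x⟩ (by omega) (G.mem_ball_self 0 x)
    (by rw [hx]; exact G.mem_ball_self 0 y)
  exact ⟨h1, by rw [h2, hx]⟩

theorem SameType.follow_eq {G : ColoredGraph V} {R : ℕ} {x y : V} (h : G.SameType R x y)
    {w w' : List Color} (hw : w.length ≤ R) (hw' : w'.length ≤ R)
    (he : follow G.move w x = follow G.move w' x) : follow G.move w y = follow G.move w' y := by
  obtain ⟨f, hf⟩ := G.exists_iso_follow h
  obtain ⟨h1, h2⟩ := hf w hw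
  obtain ⟨h3, h4⟩ := hf w' hw'
  rw [← h2, ← h4]
  congr 2
  exact Subtype.ext he

variable {G}

theorem TypeSpace.type_eq_of_le (α : G.TypeSpace) {s t : ℕ} (hst : t ≤ s) {x : V}
    (h : α.type s = G.rtype s x) : α.type t = G.rtype t x := by
  induction s, hst using Nat.le_induction with
  | base => exact h
  | succ s _ ih => exact ih (α.chain' s h)

/-- Each letter costs one level of the type, so depth `r + w.length` is needed to read off level `r`
after `w`. -/
theorem TypeSpace.follow_type (α : G.TypeSpace) (w : List Color) {r : ℕ} {x : V}
    (h : α.type (r + w.length) = G.rtype (r + w.length) x) :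
    (follow G.moveChain w α).type r = G.rtype r (follow G.move w x) := by
  induction w generalizing α x with
  | nil => exact h
  | cons c w ih =>
    apply ih
    change G.moveType c (r + w.length) (α.type (r + w.length + 1)) = _
    rw [List.length_cons, ← add_assoc] at h
    rw [h, G.moveType_rtype]

/-- Two words which agree at a vertex approximating `α` agree at `α`. -/
theorem TypeSpace.follow_eq (α : G.TypeSpace) {R : ℕ} {x : V} (hx : α.type R = G.rtype R x)
    {w w' : List Color} (hw : w.length ≤ R) (hw' : w'.length ≤ R)
    (he : follow G.move w x = follow G.move w' x) :
    follow G.moveChain w α = follow G.moveChain w' α := by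
  apply TypeSpace.ext'
  intro r
  -- The vertex `x` approximates `α` only to depth `R`. A deeper approximation `y` has the same
  -- `R`-type, so the two words agree at `y` too, and `y` determines level `r` of both sides.
  obtain ⟨y, hy⟩ := G.rtype_surj (α.type (r + R))
  have h1 : G.SameType R x y := by
    have h2 := α.type_eq_of_le (t := R) (by omega) hy.symm
    exact Quotient.exact (hx.symm.trans h2)
  rw [α.follow_type w (α.type_eq_of_le (by omega) hy.symm),
    α.follow_type w' (α.type_eq_of_le (by omega) hy.symm), h1.follow_eq hw hw' he]

end ColoredGraph

/-! ### Partially equivariant maps from stages -/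

/-- `g` commutes with all moves, except possibly the move `D` at the marked vertex. -/
def Stage.Equivariant (S : Stage) {X : Type*} (m : Color → X → X) (g : S.V → X) : Prop :=
  ∀ c v, ¬ (v = S.r ∧ c = Color.D) → m c (g v) = g (S.G.move c v)

/-- Every vertex can be moved to the marked vertex by at most `d` moves. -/
def Stage.Within (S : Stage) (d : ℕ) : Prop :=
  ∀ v, ∃ w : List Color, w.length ≤ d ∧ follow S.G.move w v = S.r

namespace Stage

variable {S T : Stage} {X : Type*} {m : Color → X → X}

theorem move_D_r (S : Stage) : S.G.move Color.D S.r = S.r :=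
  S.G.move_eq_self fun ⟨y, hy⟩ => S.free y hy

/-- Cutting the word at its first arrival at the marked vertex avoids the one move that `g` need not
respect. -/
theorem Equivariant.exists_follow {g : S.V → X} (hg : S.Equivariant m g) (w : List Color)
    (v : S.V) (hw : follow S.G.move w v = S.r) :
    ∃ w' : List Color, w'.length ≤ w.length ∧ follow m w' (g v) = g S.r := by
  induction w generalizing v with
  | nil => exact ⟨[], le_rfl, congrArg g hw⟩
  | cons c w ih =>
    by_cases hv : v = S.r
    · exact ⟨[], by simp, congrArg g hv⟩
    · obtain ⟨w', h1, h2⟩ := ih (S.G.move c v) hw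
      refine ⟨c :: w', by simpa using h1, ?_⟩
      rw [follow_cons, hg c v fun h => hv h.1, h2]

/-- If `g v = g v'`, a word leading `v` to the marked vertex can be applied to both points. The
exceptional move could separate them only if one is at the marked vertex and the other is not; then
`D` commutes with `g` at the other, which puts the exit `m D (g r)` into the image. -/
theorem Equivariant.injective {g : S.V → X} (hg : S.Equivariant m g) {d : ℕ} (hS : S.Within d)
    (hD : ∀ v, g v ≠ m Color.D (g S.r)) : Function.Injective g := by
  have key : ∀ (w : List Color) (v v' : S.V), follow S.G.move w v = S.r → g v = g v' → v = v' := by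
    intro w
    induction w with
    | nil =>
      intro v v' hv he
      change v = S.r at hv
      subst hv
      by_contra hne
      refine hD (S.G.move Color.D v') ?_
      rw [he, hg _ v' fun h => hne h.1.symm]
    | cons c w ih =>
      intro v v' hv he
      -- Inside `S` the letter `D` fixes the marked vertex, so here it is dropped from the word and
      -- `v'` stays in place.
      by_cases h1 : v = S.r ∧ c = Color.D
      · obtain ⟨rfl, rfl⟩ := h1
        rw [follow_cons, S.move_D_r] at hv
        exact ih _ _ hv he
      · by_cases h2 : v' = S.r ∧ c = Color.D
        · obtain ⟨rfl, rfl⟩ := h2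
          exact absurd (by rw [← he, hg _ v h1]) (hD (S.G.move Color.D v))
        · have : S.G.move c v = S.G.move c v' := ih _ (S.G.move c v') hv (by rw [← hg c v h1, ← hg c v' h2, he])
          rw [← S.G.move_move c v, this, S.G.move_move]
  intro v v' he
  obtain ⟨w, -, hw⟩ := hS v
  exact key w v v' hw he

theorem Equivariant.comp {g : T.V → X} (hg : T.Equivariant m g) {f : S.V → T.V}
    (hf : S.Equivariant T.G.move f) (hr : ∀ v, f v = T.r → v = S.r) :
    S.Equivariant m (g ∘ f) := by
  intro c v h
  change m c (g (f v)) = g (f (S.G.move c v))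
  rw [hg c (f v) fun h' => h ⟨hr v h'.1, h'.2⟩, hf c v h]

theorem equivariant_id (S : Stage) : S.Equivariant S.G.move id := fun _ _ _ => rfl

theorem Iso.move (e : S.Iso T) (c : Color) (v : S.V) :
    T.G.move c (e.equiv v) = e.equiv (S.G.move c v) := by
  by_cases h : ∃ w, S.G.adj c v w
  · obtain ⟨w, hw⟩ := h
    rw [S.G.move_eq hw]
    exact T.G.move_eq ((e.adj_iff c v w).2 hw)
  · rw [S.G.move_eq_self h]
    apply T.G.move_eq_self
    rintro ⟨w, hw⟩
    refine h ⟨e.equiv.symm w, ?_⟩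
    rw [← e.adj_iff, Equiv.apply_symm_apply]
    exact hw

theorem Iso.equivariant (e : S.Iso T) : S.Equivariant T.G.move e.equiv := fun c v _ => e.move c v

theorem Iso.follow (e : S.Iso T) (w : List Color) (v : S.V) :
    follow T.G.move w (e.equiv v) = e.equiv (follow S.G.move w v) := by
  induction w generalizing v with
  | nil => rfl
  | cons c w ih => rw [follow_cons, e.move, ih, follow_cons]

theorem Iso.within (e : S.Iso T) {d : ℕ} (h : S.Within d) : T.Within d := by
  intro v
  obtain ⟨w, h1, h2⟩ := h (e.equiv.symm v)
  refine ⟨w, h1, ?_⟩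
  rw [← e.map_r, ← h2, ← e.follow, Equiv.apply_symm_apply]

theorem Within.mono {d d' : ℕ} (h : S.Within d) (hd : d ≤ d') : S.Within d' := fun v =>
  let ⟨w, h1, h2⟩ := h v
  ⟨w, h1.trans hd, h2⟩

theorem exists_within (h : ∀ v, ∃ w : List Color, follow S.G.move w v = S.r) :
    ∃ d, S.Within d := by
  choose w hw using h
  have := S.finite
  obtain ⟨d, hd⟩ := (Set.finite_range fun v => (w v).length).bddAbove
  exact ⟨d, fun v => ⟨w v, hd ⟨v, rfl⟩, hw v⟩⟩

end Stage

/-! ### Moving around inside one step of the construction -/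

namespace StepChoice

variable {m : ℕ} {N : ℕ → Subgroup GamTilde} {K : ℕ → Stage} {n : ℕ} (s : StepChoice m N K n)

theorem netScale_pos (hm : 0 < m) (j : ℕ) : 0 < netScale m K j :=
  Nat.mul_pos (Nat.pow_pos hm) (Nat.pow_pos two_pos)

/-- `diam` takes the value `0` when the extended diameter is infinite, so the positive lower bound
on it forces connectedness. -/
theorem H_connected (hm : 0 < m) : s.H.graph.Connected := by
  have : Nonempty s.W := ⟨s.r⟩
  refine SimpleGraph.connected_of_ediam_ne_top (SimpleGraph.ediam_ne_top_of_diam_ne_zero ?_)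
  have h1 := s.diam_le
  have h2 := netScale_pos (K := K) hm n
  omega

theorem part_copy_ne_r {u : s.W} (hu : s.part u ≤ n) : u ≠ s.r := by
  rintro rfl
  rw [s.part_r] at hu
  omega

theorem core_ne_r {u : s.W} (hu : u ≠ s.r) : (Vertex.core u : s.Vertex) ≠ s.next.r := by
  intro h
  cases h
  exact hu rfl

theorem path_ne_r (i : Fin s.colors.length) : (Vertex.path i : s.Vertex) ≠ s.next.r := by
  intro h
  cases h

theorem move_core {c : Color} {u v : s.W} (h : s.H.adj c u v) :
    s.next.G.move c (.core u : s.Vertex) = (.core v : s.Vertex) :=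
  s.graph.move_eq (Or.inl (.core h))

theorem copy_equivariant {u : s.W} (hu : s.part u < n) :
    (K (s.part u)).Equivariant s.next.G.move (fun v => (.copy u hu v : s.Vertex)) := by
  intro c v hv
  by_cases h : ∃ w, (K (s.part u)).G.adj c v w
  · obtain ⟨w, hw⟩ := h
    rw [(K (s.part u)).G.move_eq hw]
    exact s.graph.move_eq (Or.inl (.copy hw))
  · rw [(K (s.part u)).G.move_eq_self h]
    refine s.graph.move_eq_self ?_
    rintro ⟨y, h' | h'⟩
    · cases h' with
      | copy h' => exact h ⟨_, h'⟩
    · cases h' with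
      | copy h' => exact h ⟨_, (K _).G.symm h'⟩
      | linkCopy h' => exact hv ⟨h', rfl⟩

theorem old_equivariant :
    (K n).Equivariant s.next.G.move (fun v => (.old v : s.Vertex)) := by
  intro c v hv
  by_cases h : ∃ w, (K n).G.adj c v w
  · obtain ⟨w, hw⟩ := h
    rw [(K n).G.move_eq hw]
    exact s.graph.move_eq (Or.inl (.old hw))
  · rw [(K n).G.move_eq_self h]
    refine s.graph.move_eq_self ?_
    rintro ⟨y, h' | h'⟩
    · cases h' with
      | old h' => exact h ⟨_, h'⟩
    · cases h' with
      | old h' => exact h ⟨_, (K _).G.symm h'⟩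
      | linkOld _ h' => exact hv ⟨h', rfl⟩

theorem move_path_zero {i : Fin s.colors.length} (hi : (i : ℕ) = 0) :
    s.next.G.move Color.D (.path i : s.Vertex) = (.core s.x : s.Vertex) :=
  s.graph.move_eq (Or.inr (.linkPath rfl hi))

theorem move_path_succ {i j : Fin s.colors.length} (hj : (j : ℕ) = i + 1) :
    s.next.G.move (s.colors.get j) (.path j : s.Vertex) = (.path i : s.Vertex) :=
  s.graph.move_eq (Or.inr (.path hj rfl))

/-- A vertex of the attached path can only be moved along the path, and at most two moves are
nontrivial. -/
theorem move_path (i : Fin s.colors.length) (hi : 0 < (i : ℕ)) (c : Color) :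
    ∃ j : Fin s.colors.length, (i : ℕ) ≤ j + 1 ∧
      s.next.G.move c (.path i : s.Vertex) = (.path j : s.Vertex) := by
  by_cases h : ∃ y, s.graph.adj c (.path i) y
  · obtain ⟨y, hy⟩ := h
    have e : s.next.G.move c (.path i : s.Vertex) = y := s.graph.move_eq hy
    rcases hy with hy | hy
    · cases hy with
      | @path _ _ j hj => exact ⟨j, by omega, e⟩
    · cases hy with
      | @path _ j _ hj => exact ⟨j, by omega, e⟩
      | linkPath _ h0 => omega
  · exact ⟨i, by omega, s.graph.move_eq_self h⟩

theorem atMostTwoMoves_path (i : Fin s.colors.length) :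
    AtMostTwoMoves s.next.G.move (.path i : s.Vertex) := by
  have key : ∀ c y, s.graph.adj c (.path i) y → c = s.colors.get i ∨
      ∃ j : Fin s.colors.length, (j : ℕ) = i + 1 ∧ c = s.colors.get j := by
    rintro c y (h | h)
    · cases h with
      | @path _ _ j hj hc => exact Or.inr ⟨j, hj, hc⟩
    · cases h with
      | path _ hc => exact Or.inl hc
      | linkPath _ h0 => exact Or.inl (s.colors_zero h0).symm
  by_cases h : ∃ j : Fin s.colors.length, (j : ℕ) = i + 1
  · obtain ⟨j, hj⟩ := h
    refine ⟨s.colors.get i, s.colors.get j, fun c h1 h2 => s.graph.move_eq_self ?_⟩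
    rintro ⟨y, hy⟩
    rcases key c y hy with h | ⟨j', hj', h⟩
    · exact h1 h
    · have : j' = j := Fin.ext (by omega)
      exact h2 (this ▸ h)
  · refine ⟨s.colors.get i, s.colors.get i, fun c h1 _ => s.graph.move_eq_self ?_⟩
    rintro ⟨y, hy⟩
    rcases key c y hy with h' | ⟨j', hj', -⟩
    · exact h1 h'
    · exact h ⟨j', hj'⟩

section Navigation

variable {X : Type*} {M : Color → X → X} (hM : ∀ c x, M c (M c x) = x) {g : s.Vertex → X}
  (hg : s.next.Equivariant M g)

include hg

theorem move_apply {v w : s.Vertex} {c : Color} (hv : ¬ (v = s.next.r ∧ c = Color.D))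
    (e : s.next.G.move c v = w) : M c (g v) = g w :=
  (hg c v hv).trans (congrArg g e)

theorem exists_follow_core (hm : 0 < m) (u v : s.W) : ∃ w : List Color,
    w.length ≤ s.H.graph.dist u v ∧ follow M w (g (.core u)) = g (.core v) := by
  obtain ⟨p, hp⟩ := (s.H_connected hm).exists_walk_length_eq_dist u v
  rw [← hp]
  clear hp
  induction p with
  | nil => exact ⟨[], by simp, rfl⟩
  | cons h p ih =>
    obtain ⟨c, hc⟩ := h
    obtain ⟨w, h1, h2⟩ := ih
    refine ⟨c :: w, Nat.succ_le_succ h1, ?_⟩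
    have hcD : ¬ c = Color.D := by
      rintro rfl
      exact s.H_noD _ _ hc
    rw [follow_cons, s.move_apply hg (fun h => hcD h.2) (s.move_core hc), h2]

theorem exists_follow_path (i : Fin s.colors.length) : ∃ w : List Color,
    w.length = i + 1 ∧ follow M w (g (.path i)) = g (.core s.x) := by
  obtain ⟨i, hi⟩ := i
  induction i with
  | zero =>
    refine ⟨[Color.D], rfl, ?_⟩
    exact s.move_apply hg (fun h => s.path_ne_r _ h.1) (s.move_path_zero rfl)
  | succ i ih =>
    obtain ⟨w, h1, h2⟩ := ih (by omega)
    refine ⟨s.colors.get ⟨i + 1, hi⟩ :: w, by simpa using h1, ?_⟩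
    rw [follow_cons, s.move_apply hg (fun h => s.path_ne_r _ h.1)
      (s.move_path_succ (i := ⟨i, by omega⟩) rfl), h2]

theorem move_core_copy {u : s.W} (hu : s.part u < n) :
    M Color.D (g (.core u)) = g (.copy u hu (K (s.part u)).r) := by
  rw [hg _ _ fun h => s.core_ne_r (s.part_copy_ne_r hu.le) h.1]
  exact congrArg g (s.graph.move_eq (Or.inl (.linkCopy rfl)))

theorem move_core_old : M Color.D (g (.core s.a)) = g (.old (K n).r) := by
  rw [hg _ _ fun h => s.core_ne_r (s.part_copy_ne_r s.part_a.le) h.1]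
  exact congrArg g (s.graph.move_eq (Or.inl (.linkOld rfl rfl)))

theorem comp_copy {u : s.W} (hu : s.part u < n) :
    (K (s.part u)).Equivariant M (fun v => g (.copy u hu v)) :=
  Stage.Equivariant.comp (T := s.next) hg (s.copy_equivariant hu) fun _ h => by cases h

theorem comp_old : (K n).Equivariant M (fun v => g (.old v)) :=
  Stage.Equivariant.comp (T := s.next) hg s.old_equivariant fun _ h => by cases h

/-- Each move lowers the position on the path by at most one, so from position at least `k` a word
of length at most `k` cannot leave the path. -/
theorem follow_path {k : ℕ} (i : Fin s.colors.length) (hk : k ≤ i) (w : List Color)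
    (hw : w.length ≤ k) : ∃ j : Fin s.colors.length, follow M w (g (.path i)) = g (.path j) := by
  induction w generalizing i k with
  | nil => exact ⟨i, rfl⟩
  | cons c w ih =>
    rw [List.length_cons] at hw
    obtain ⟨j, hj, e⟩ := s.move_path i (by omega) c
    rw [follow_cons, s.move_apply hg (fun h => s.path_ne_r _ h.1) e]
    exact ih (k := w.length) j (by omega) le_rfl

include hM in
theorem exists_follow_copy_core {u : s.W} (hu : s.part u < n) {d : ℕ}
    (hd : (K (s.part u)).Within d) (v : (K (s.part u)).V) : ∃ w : List Color,
    w.length ≤ d + 1 ∧ follow M w (g (.copy u hu v)) = g (.core u) := by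
  obtain ⟨w, h1, h2⟩ := hd v
  obtain ⟨w', h3, h4⟩ := (s.comp_copy hg hu).exists_follow w v h2
  refine ⟨w' ++ [Color.D], by rw [List.length_append, List.length_singleton]; omega, ?_⟩
  rw [follow_append, h4, ← s.move_core_copy hg hu, follow_cons, hM, follow_nil]

include hM in
theorem exists_follow_old_core {d : ℕ} (hd : (K n).Within d) (v : (K n).V) : ∃ w : List Color,
    w.length ≤ d + 1 ∧ follow M w (g (.old v)) = g (.core s.a) := by
  obtain ⟨w, h1, h2⟩ := hd v
  obtain ⟨w', h3, h4⟩ := (s.comp_old hg).exists_follow w v h2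
  refine ⟨w' ++ [Color.D], by rw [List.length_append, List.length_singleton]; omega, ?_⟩
  rw [follow_append, h4, ← s.move_core_old hg, follow_cons, hM, follow_nil]

/-- Each vertex of the core is close to the marked vertex of a copy of `G_i`. -/
theorem exists_follow_core_copy (hm : 0 < m) {i : ℕ} (hi : i < n) (u : s.W) :
    ∃ f : (K i).V → X, (K i).Equivariant M f ∧ ∃ w : List Color,
      w.length ≤ 10 * netScale m K i + 1 ∧ follow M w (g (.core u)) = f (K i).r := by
  obtain ⟨v, rfl, hv⟩ := s.dense i hi.le u
  obtain ⟨w, h1, h2⟩ := s.exists_follow_core hg hm u v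
  rw [SimpleGraph.dist_comm] at hv
  refine ⟨_, s.comp_copy hg hi, w ++ [Color.D],
    by rw [List.length_append, List.length_singleton]; omega, ?_⟩
  rw [follow_append, h2, follow_cons, follow_nil, s.move_core_copy hg hi]

end Navigation

theorem next_within (hm : 0 < m) (h : ∀ j ≤ n, ∃ d, (K j).Within d) : ∃ d, s.next.Within d := by
  have hid := s.next.equivariant_id
  have core : ∀ u : s.W, ∃ w, follow s.next.G.move w (.core u : s.Vertex) = s.next.r := fun u =>
    let ⟨w, _, hw⟩ := s.exists_follow_core hid hm u s.r
    ⟨w, hw⟩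
  have via : ∀ (v : s.Vertex) (u : s.W) (w : List Color),
      follow s.next.G.move w v = (.core u : s.Vertex) →
      ∃ w, follow s.next.G.move w v = s.next.r := by
    intro v u w hw
    obtain ⟨w', hw'⟩ := core u
    exact ⟨w ++ w', (follow_append _ w w' v).trans
      ((congrArg (follow s.next.G.move w') hw).trans hw')⟩
  refine Stage.exists_within fun v => ?_
  rcases v with u | ⟨u, hu, v⟩ | v | i
  · exact core u
  · obtain ⟨d, hd⟩ := h _ hu.le
    obtain ⟨w, -, hw⟩ := s.exists_follow_copy_core s.next.G.move_move hid hu hd v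
    exact via _ _ w hw
  · obtain ⟨d, hd⟩ := h n le_rfl
    obtain ⟨w, -, hw⟩ := s.exists_follow_old_core s.next.G.move_move hid hd v
    exact via _ _ w hw
  · obtain ⟨w, -, hw⟩ := s.exists_follow_path hid i
    exact via _ _ w hw

theorem card_lt_card_next : Nat.card (K n).V < Nat.card s.next.V := by
  have := s.next.finite
  let f : Option (K n).V → s.next.V := fun v => v.elim (.core s.r) .old
  have hf : Function.Injective f := by
    rintro (_ | v) (_ | w) h
    · rfl
    · cases h
    · cases h
    · cases h; rfl
  have := (K n).finite
  have h := Nat.card_le_card_of_injective f hf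
  rwa [Finite.card_option] at h

end StepChoice

/-! ### Copies of early stages throughout `G` -/

theorem stageOne_within (q r : Fin 3) (h : r ≠ q) : ∃ d, (stageOne q r h).Within d := by
  set S := stageOne q r h
  have hA : S.G.move Color.A (some 0) = some 1 := S.G.move_eq (Or.inl .a)
  have hA' : S.G.move Color.A (some 1) = some 0 := S.G.move_eq (Or.inr .a)
  have hB : S.G.move Color.B (some 1) = some 2 := S.G.move_eq (Or.inl .b)
  have hB' : S.G.move Color.B (some 2) = some 1 := S.G.move_eq (Or.inr .b)
  have hC : S.G.move Color.C (some 2) = some 0 := S.G.move_eq (Or.inl .c)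
  have hC' : S.G.move Color.C (some 0) = some 2 := S.G.move_eq (Or.inr .c)
  have hD : S.G.move Color.D none = some q := S.G.move_eq (Or.inr .d)
  have tri : ∀ i j : Fin 3, ∃ w, follow S.G.move w (some i) = (some j : Option (Fin 3)) := by
    intro i j
    fin_cases i <;> fin_cases j
    · exact ⟨[], rfl⟩
    · exact ⟨[Color.A], hA⟩
    · exact ⟨[Color.C], hC'⟩
    · exact ⟨[Color.A], hA'⟩
    · exact ⟨[], rfl⟩
    · exact ⟨[Color.B], hB⟩
    · exact ⟨[Color.C], hC⟩
    · exact ⟨[Color.B], hB'⟩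
    · exact ⟨[], rfl⟩
  refine Stage.exists_within fun v => ?_
  rcases v with _ | i
  · obtain ⟨w, hw⟩ := tri q r
    exact ⟨Color.D :: w, (congrArg (follow S.G.move w) hD).trans hw⟩
  · exact tri i r

namespace MainConstruction

variable {m : ℕ} {N : ℕ → Subgroup GamTilde} {V : Type*} {G : ColoredGraph V}
  (C : MainConstruction m N G)

theorem exists_within (hm : 0 < m) (n : ℕ) : ∃ d, (C.K n).Within d := by
  induction n using Nat.strong_induction_on with
  | _ n ih =>
    match n with
    | 0 => exact ⟨0, C.zero.within fun v => ⟨[], le_rfl, rfl⟩⟩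
    | 1 =>
      obtain ⟨d, hd⟩ := stageOne_within C.q C.r C.r_ne_q
      exact ⟨d, C.one.within hd⟩
    | n + 2 =>
      obtain ⟨d, hd⟩ := (C.step (n + 1) (by omega)).next_within hm fun j hj => ih j (by omega)
      exact ⟨d, (C.succ (n + 1) (by omega)).within hd⟩

theorem exists_within_of_le (hm : 0 < m) (n : ℕ) : ∃ d, ∀ j ≤ n, (C.K j).Within d := by
  choose d hd using C.exists_within hm
  refine ⟨(Finset.range (n + 1)).sup d, fun j hj => (hd j).mono ?_⟩
  exact Finset.le_sup (f := d) (Finset.mem_range.2 (by omega))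

theorem le_card (n : ℕ) : n ≤ Nat.card (C.K n).V := by
  induction n with
  | zero => exact Nat.zero_le _
  | succ n ih =>
    rcases Nat.eq_zero_or_pos n with rfl | hn
    · have := (C.K 1).finite
      have : Nonempty (C.K 1).V := ⟨(C.K 1).r⟩
      exact Nat.card_pos
    · rw [← Nat.card_congr (C.succ n hn).equiv]
      exact Nat.succ_le_of_lt (ih.trans_lt (C.step n hn).card_lt_card_next)

/-- The inclusion of `G_n` in `G_k`, for `1 ≤ n ≤ k`. -/
theorem exists_factor {n k : ℕ} (hn : 1 ≤ n) (hk : n ≤ k) : ∃ f : (C.K n).V → (C.K k).V,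
    (C.K n).Equivariant (C.K k).G.move f ∧ (∀ v, f v = (C.K k).r → v = (C.K n).r) ∧
      ∀ v, C.incl n v = C.incl k (f v) := by
  induction k, hk using Nat.le_induction with
  | base => exact ⟨id, (C.K n).equivariant_id, fun _ h => h, fun _ => rfl⟩
  | succ k hk ih =>
    obtain ⟨f, h1, h2, h3⟩ := ih
    have hk1 : 1 ≤ k := hn.trans hk
    let e := C.succ k hk1
    -- The new marked vertex lies in the core, so the old stage avoids it and its exceptional move
    -- does not interfere with the composition.
    have he : ∀ v, e.equiv (StepChoice.Vertex.old v) ≠ (C.K (k + 1)).r := by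
      intro v h
      rw [← e.map_r] at h
      cases e.equiv.injective h
    have hE : (C.K k).Equivariant (C.K (k + 1)).G.move
        (fun v => e.equiv (StepChoice.Vertex.old v)) :=
      (C.step k hk1).comp_old e.equivariant
    refine ⟨_, hE.comp h1 h2, fun v h => absurd h (he _), fun v => ?_⟩
    rw [h3, C.incl_succ k hk1]
    rfl

/-- An edge of `G` at a vertex of `G_n` already lives in some finite stage. If that stage is later
than `G_n`, the factor map says that the move there is the one in `G_n`; were that trivial, the edge
would be a loop. -/
theorem incl_equivariant {n : ℕ} (hn : 1 ≤ n) : (C.K n).Equivariant G.move (C.incl n) := by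
  intro c v hv
  by_cases h : ∃ w, (C.K n).G.adj c v w
  · obtain ⟨w, hw⟩ := h
    rw [(C.K n).G.move_eq hw]
    exact G.move_eq ((C.incl_adj n c v w).2 hw)
  · rw [(C.K n).G.move_eq_self h]
    apply G.move_eq_self
    rintro ⟨y, hy⟩
    obtain ⟨k, z, rfl⟩ : ∃ k z, C.incl (k + 1) z = y := by
      obtain ⟨k, z, hz⟩ := C.exhaust y
      rcases Nat.eq_zero_or_pos k with rfl | hk
      · exact ⟨0, _, (C.incl_zero z).symm.trans hz⟩
      · exact ⟨k - 1, by rw [Nat.sub_add_cancel hk]; exact ⟨z, hz⟩⟩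
    rcases le_total (k + 1) n with hk | hk
    · obtain ⟨f, -, -, h3⟩ := C.exists_factor (by omega) hk
      rw [h3, C.incl_adj] at hy
      exact h ⟨_, hy⟩
    · obtain ⟨f, h1, -, h3⟩ := C.exists_factor hn hk
      rw [h3, C.incl_adj] at hy
      have e := h1 c v hv
      rw [(C.K n).G.move_eq_self h, (C.K (k + 1)).G.move_eq hy] at e
      rw [e] at hy
      exact (C.K (k + 1)).G.irrefl hy

/-- Every vertex is close to the marked vertex of a copy of `G_i`, or its neighbourhood is part of
a path. -/
theorem near_copy_or_path (hm : 0 < m) (i : ℕ) : ∃ ρ : ℕ, ∀ (k : ℕ) (x : V),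
    (∃ f : (C.K i).V → V, (C.K i).Equivariant G.move f ∧ ∃ w : List Color,
      w.length ≤ ρ + k ∧ follow G.move w x = f (C.K i).r) ∨
    ∀ w : List Color, w.length ≤ k → AtMostTwoMoves G.move (follow G.move w x) := by
  obtain ⟨d, hd⟩ := C.exists_within_of_le hm (i + 1)
  -- At most `d + 1` moves from a copy of a stage of index at most `i + 1` to the core, `10 *
  -- netScale m C.K i` to the net, and one `D`-edge into the copy of `G_i`. The slack `k` pays for
  -- leaving a path from a position below `k`.
  refine ⟨d + 1 + (10 * netScale m C.K i + 1), fun k => ?_⟩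
  -- Induction over arbitrary equivariant maps `g`, not only the inclusions, so that it applies to
  -- copies nested in later stages. The bound `i + 1 < n` ensures that the core of `G_n` carries
  -- copies of `G_i`.
  have key : ∀ n, i + 1 < n → ∀ g : (C.K n).V → V, (C.K n).Equivariant G.move g →
      ∀ v : (C.K n).V, (∃ f : (C.K i).V → V, (C.K i).Equivariant G.move f ∧ ∃ w : List Color,
        w.length ≤ d + 1 + (10 * netScale m C.K i + 1) + k ∧
          follow G.move w (g v) = f (C.K i).r) ∨
      ∀ w : List Color, w.length ≤ k → AtMostTwoMoves G.move (follow G.move w (g v)) := by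
    intro n
    induction n using Nat.strong_induction_on with
    | _ n ih =>
      intro hn g hg v
      obtain ⟨n, rfl⟩ : ∃ l, n = l + 1 := ⟨n - 1, by omega⟩
      have hn1 : 1 ≤ n := by omega
      let e := C.succ n hn1
      let s := C.step n hn1
      have hg' : s.next.Equivariant G.move (g ∘ e.equiv) :=
        hg.comp e.equivariant fun v h => e.equiv.injective (h.trans e.map_r.symm)
      obtain ⟨v, rfl⟩ := e.equiv.surjective v
      have core : ∀ (u : s.W) (x : V) (w : List Color), w.length ≤ d + 1 + k →
          follow G.move w x = g (e.equiv (StepChoice.Vertex.core u)) →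
          ∃ f : (C.K i).V → V, (C.K i).Equivariant G.move f ∧ ∃ w : List Color,
            w.length ≤ d + 1 + (10 * netScale m C.K i + 1) + k ∧
              follow G.move w x = f (C.K i).r := by
        intro u x w hw hx
        obtain ⟨f, hf, w', h1, h2⟩ := s.exists_follow_core_copy hg' hm (by omega : i < n) u
        refine ⟨f, hf, w ++ w', by rw [List.length_append]; omega, ?_⟩
        rw [follow_append, hx]
        exact h2
      rcases v with u | ⟨u, hu, v⟩ | v | p
      · exact Or.inl (core u _ [] (by simp) rfl)
      · have hu' : s.part u < n := hu
        by_cases hi : i + 1 < s.part u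
        · exact ih _ (by omega) hi _ (s.comp_copy hg' hu) v
        · obtain ⟨w, h1, h2⟩ :=
            s.exists_follow_copy_core G.move_move hg' hu (hd _ (by omega)) v
          exact Or.inl (core u _ w (by omega) h2)
      · by_cases hi : i + 1 < n
        · exact ih _ (by omega) hi _ (s.comp_old hg') v
        · obtain ⟨w, h1, h2⟩ :=
            s.exists_follow_old_core G.move_move hg' (hd _ (by omega)) v
          exact Or.inl (core s.a _ w (by omega) h2)
      · by_cases hp : k ≤ p
        · right
          intro w hw
          obtain ⟨j, hj⟩ := s.follow_path hg' p hp w hw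
          change follow G.move w (g (e.equiv (StepChoice.Vertex.path p))) = _ at hj
          rw [hj]
          obtain ⟨c₁, c₂, h⟩ := s.atMostTwoMoves_path j
          refine ⟨c₁, c₂, fun c h1 h2 => ?_⟩
          exact s.move_apply hg' (fun h => s.path_ne_r _ h.1) (h c h1 h2)
        · obtain ⟨w, h1, h2⟩ := s.exists_follow_path hg' p
          exact Or.inl (core s.x _ w (by omega) h2)
  intro x
  obtain ⟨n, v, rfl⟩ := C.exhaust x
  obtain ⟨n', v', hn', he⟩ : ∃ n' v', i + 1 < n' ∧ C.incl n v = C.incl n' v' := by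
    rcases Nat.eq_zero_or_pos n with rfl | hn
    · obtain ⟨f, -, -, hf⟩ := C.exists_factor le_rfl (by omega : 1 ≤ i + 2)
      exact ⟨i + 2, _, by omega, (C.incl_zero v).trans (hf _)⟩
    · obtain ⟨f, -, -, hf⟩ := C.exists_factor hn (by omega : n ≤ n + (i + 2))
      exact ⟨n + (i + 2), _, by omega, hf v⟩
  rw [he]
  exact key n' hn' _ (C.incl_equivariant (by omega)) v'

end MainConstruction

/-! ### Transfer from `G` to the leaf -/

open Classical in
/-- A copy of a stage near a vertex approximating `α` yields a finite subset of the leaf with at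
most one boundary point. -/
theorem exists_finset_of_copy {V : Type*} {G : ColoredGraph V} (α : G.TypeSpace) {S : Stage}
    {d k R : ℕ} (hS : S.Within d) (hR : k + d + 1 ≤ R) {x : V} (hx : α.type R = G.rtype R x)
    {f : S.V → V} (hf : S.Equivariant G.move f) {w : List Color} (hw : w.length ≤ k)
    (hwx : follow G.move w x = f S.r) :
    ∃ Ω : Finset (MulAction.orbit Gam α), Ω.Nonempty ∧ ((∀ y ∈ Ω, ∀ c, gen c • y ∈ Ω) ∨
      Nat.card S.V ≤ Ω.card ∧ ∃ a b, ∀ y ∈ Ω, ∀ c, gen c • y ∉ Ω → y = a ∨ y = b) := by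
  have hword : ∀ v, ∃ t : List Color, t.length ≤ d ∧ follow G.move t (f S.r) = f v := by
    intro v
    obtain ⟨t, h1, h2⟩ := hS v
    obtain ⟨t', h3, h4⟩ := hf.exists_follow t v h2
    exact ⟨t'.reverse, by rw [List.length_reverse]; omega,
      by rw [← h4, follow_reverse _ G.move_move]⟩
  choose t ht1 ht2 using hword
  let M : Color → MulAction.orbit Gam α → MulAction.orbit Gam α := fun c y => gen c • y
  let α' : MulAction.orbit Gam α := ⟨α, MulAction.mem_orbit_self α⟩
  -- The point `Φ v` is reached from `α` by the word that leads from `x` to `f v` through the marked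
  -- vertex. The words compared below have length at most `k + d + 1`.
  let Φ : S.V → MulAction.orbit Gam α := fun v => follow M (w ++ t v) α'
  have hΦ : S.Equivariant M Φ := by
    intro c v hv
    change follow M [c] (follow M (w ++ t v) α') = follow M (w ++ t (S.G.move c v)) α'
    rw [← follow_append]
    apply Subtype.ext
    rw [coe_follow, coe_follow]
    have h1 := ht1 v
    have h2 := ht1 (S.G.move c v)
    refine α.follow_eq hx ?_ ?_ ?_
    · simp only [List.length_append, List.length_singleton]; omega
    · simp only [List.length_append]; omega
    · rw [follow_append, follow_append, follow_append, hwx, ht2, ht2, ← hf c v hv]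
      rfl
  have := S.finite
  have := Fintype.ofFinite S.V
  have hmem : ∀ y, y ∈ Finset.univ.image Φ ↔ ∃ v, Φ v = y := by simp
  refine ⟨Finset.univ.image Φ, ⟨Φ S.r, (hmem _).2 ⟨_, rfl⟩⟩, ?_⟩
  -- Either the exit at the marked vertex leaves the image, which then is a faithful copy of `S`
  -- with one boundary point, or it returns to the image, which is then invariant.
  by_cases hD : ∀ v, Φ v ≠ M Color.D (Φ S.r)
  · right
    refine ⟨?_, Φ S.r, Φ S.r, fun y hy c hc => ?_⟩
    · rw [Finset.card_image_of_injective _ (hΦ.injective hS hD), Finset.card_univ,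
        Nat.card_eq_fintype_card]
    · obtain ⟨v, rfl⟩ := (hmem y).1 hy
      by_contra hcon
      exact hc ((hmem _).2 ⟨_, (hΦ c v fun h => hcon (Or.inl (by rw [h.1]))).symm⟩)
  · left
    push Not at hD
    intro y hy c
    obtain ⟨v, rfl⟩ := (hmem y).1 hy
    by_cases h : v = S.r ∧ c = Color.D
    · obtain ⟨rfl, rfl⟩ := h
      exact (hmem _).2 hD
    · exact (hmem _).2 ⟨_, (hΦ c v h).symm⟩

/-- If arbitrarily large neighbourhoods of the root of `α` have degree at most two, then so does
the leaf of `α`. -/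
theorem atMostTwoMoves_orbit {V : Type*} {G : ColoredGraph V} (α : G.TypeSpace)
    (h : ∀ k, ∃ R, k + 1 ≤ R ∧ ∃ x, α.type R = G.rtype R x ∧
      ∀ w : List Color, w.length ≤ k → AtMostTwoMoves G.move (follow G.move w x))
    (y : MulAction.orbit Gam α) : AtMostTwoMoves (fun c z => gen c • z) y := by
  obtain ⟨w, hw⟩ := exists_follow_of_mem_orbit G y.2
  obtain ⟨R, hR, x, hx, hk⟩ := h w.length
  obtain ⟨c₁, c₂, hc⟩ := hk w le_rfl
  refine ⟨c₁, c₂, fun c h1 h2 => Subtype.ext ?_⟩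
  rw [MulAction.orbit.coe_smul, typeAction_gen, hw]
  have : follow G.moveChain (w ++ [c]) α = follow G.moveChain w α := by
    refine α.follow_eq hx ?_ (by omega) ?_
    · rw [List.length_append, List.length_singleton]; omega
    · rw [follow_append, follow_cons, follow_nil, hc c h1 h2]
  rwa [follow_append] at this

end TypeSpaceAction

theorem mainTheorem9 (m : ℕ) (hm : 10 < m)
    (N : ℕ → Subgroup TypeSpaceAction.GamTilde)
    (hN_normal : ∀ i, (N i).Normal) (hN_index : ∀ i, (N i).FiniteIndex)
    (hN_anti : Antitone N) (hN_inf : ⨅ i, N i = ⊥)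
    {V : Type*} (G : TypeSpaceAction.ColoredGraph V)
    (hG : Nonempty (TypeSpaceAction.MainConstruction m N G)) (α : G.TypeSpace) :
    TypeSpaceAction.IsAmenableGraph (TypeSpaceAction.leaf G α) := by
  obtain ⟨C⟩ := hG
  have hm0 : 0 < m := by omega
  have : Nonempty (MulAction.orbit TypeSpaceAction.Gam α) := ⟨⟨α, MulAction.mem_orbit_self α⟩⟩
  choose x hx using fun R => G.rtype_surj (α.type R)
  -- The condition does not involve `i`. Its failure gives a `k` such that every vertex
  -- approximating `α` to depth at least `k + 1` has a vertex with more than two nontrivial moves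
  -- within `k` moves, which rules out the path alternative below.
  by_cases h : ∃ i : ℕ, ∀ k : ℕ, ∃ R, k + 1 ≤ R ∧ ∃ x, α.type R = G.rtype R x ∧
      ∀ w : List TypeSpaceAction.Color, w.length ≤ k →
        TypeSpaceAction.AtMostTwoMoves G.move (TypeSpaceAction.follow G.move w x)
  · obtain ⟨i, h⟩ := h
    exact TypeSpaceAction.isAmenableGraph_of_atMostTwoMoves
      (TypeSpaceAction.atMostTwoMoves_orbit α h)
  · refine TypeSpaceAction.isAmenableGraph_of_boundary fun i => ?_
    push Not at h
    obtain ⟨k, hk⟩ := h i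
    obtain ⟨d, hd⟩ := C.exists_within hm0 i
    obtain ⟨ρ, hρ⟩ := C.near_copy_or_path hm0 i
    -- Depth `ρ + k + d + 1` covers the word to the marked vertex, a word inside the copy, and one
    -- further move.
    rcases hρ k (x (ρ + k + d + 1)) with ⟨f, hf, w, hw, hwx⟩ | hpath
    · obtain ⟨Ω, h1, h2⟩ := TypeSpaceAction.exists_finset_of_copy α hd le_rfl (hx _).symm hf hw hwx
      exact ⟨Ω, h1, h2.imp_right fun h3 => ⟨(C.le_card i).trans h3.1, h3.2⟩⟩
    · obtain ⟨w, hw, hw'⟩ := hk _ (by omega) _ (hx (ρ + k + d + 1)).symm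
      exact absurd (hpath w hw) hw'
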